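/- Let $f=\log$, let $\varepsilon\in(0,1)$, and let $A\in\mathbb{R}^{n\times n}$ be a symmetric positive definite matrix with smallest eigenvalue $\lambda_{\min}\ge 1$ and largest eigenvalue $\lambda_{\max}$. Put $$M_\rho=\bigl|\log(\lambda_{\min}/2)\bigr|+\pi,\qquad \rho=\frac{\lambda_{\max}+\sqrt{2\lambda_{\max}\lambda_{\min}-\lambda_{\min}^2}}{\lambda_{\max}-\lambda_{\min}},$$ $$C=(n-1)f(\lambda_{\min})+f(\lambda_{\max}),\qquad C_\rho=\frac{4M_\rho}{C(\rho^2-\rho)}.$$ Let $S\in\mathbb{R}^{n\times q}$ be a random matrix with independent entries $S_{ij}\sim\mathcal N(0,1/q)$, and let $Q\in\mathbb{R}^{n\times k}$ consist of $k$ principal orthonormal basis vectors of the column space of $f(A)S$; that is, $Q^TQ=I_k$ and $P=QQ^T$ minimises $\|f(A)S-Pf(A)S\|_F$ over all orthogonal projections $P$ of rank $k$. For a unit vector $v$, run $m'+1$ steps of the Lanczos algorithm for $A$ started at $v$ (stopping earlier if a residual vanishes), let $T$ be the resulting Jacobi matrix, with eigenvalues $\theta_l$ and a corresponding orthonormal basis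 of eigenvectors $y_l$, and put $\tau_l=(e_1^Ty_l)^2$. The $(m'+1)$-step Lanczos quadrature of $v^Tf(A)v$ is $\sum_l\tau_l f(\theta_l)$. Let $L_{m'+1}(Q^Tf(A)Q)$ be the sum of these quadratures over the $k$ columns $v=Q_{*1},\dots,Q_{*k}$ of $Q$. If the integer $m'\ge 0$ satisfies $$m'\ \ge\ \frac12\,\log\!\left(\frac{2kC_\rho}{\varepsilon}\right)\Big/\log\rho$$ (no condition on $m'$ is imposed when $\lambda_{\min}=\lambda_{\max}$, that is, when $\rho=+\infty$), then, for every realization of $S$ and every such $Q$, $$\left|\operatorname{tr}\bigl(Q^Tf(A)Q\bigr)-L_{m'+1}\bigl(Q^Tf(A)Q\bigr)\right|\ \le\ \frac{\varepsilon}{2}\,\operatorname{tr} f(A).$$ -/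

import Mathlib

open Matrix

noncomputable section

namespace LanczosQuadrature

/-- The Euclidean norm of a vector with `n` real coordinates. -/
def norm2 {n : ℕ} (x : Fin n → ℝ) : ℝ := √(x ⬝ᵥ x)

/-- The squared Frobenius norm of a real matrix. -/
def frobSq {n q : ℕ} (B : Matrix (Fin n) (Fin q) ℝ) : ℝ := ∑ i, ∑ j, B i j ^ 2

/-- `Q` consists of `k` principal orthonormal basis vectors for the column space of `B`:
the columns of `Q` are orthonormal, and `Q Qᵀ` minimises `‖B - P B‖_F` over all
orthogonal projections `P = W Wᵀ` of rank `k`. -/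
def IsPrincipalBasis {n q k : ℕ} (B : Matrix (Fin n) (Fin q) ℝ)
    (Q : Matrix (Fin n) (Fin k) ℝ) : Prop :=
  Qᵀ * Q = 1 ∧ ∀ W : Matrix (Fin n) (Fin k) ℝ, Wᵀ * W = 1 →
    frobSq (B - Q * Qᵀ * B) ≤ frobSq (B - W * Wᵀ * B)

/-- The Lanczos algorithm for `A` with starting vector `v`. The state after index `j` is
`(v_{j-1}, v_j, η_j)`, where `v_0 = v / ‖v‖`, `v_{-1} = 0`, `η_0 = 0` and, with
`α_j = v_jᵀ A v_j` and the residual `r = A v_j - α_j v_j - η_j v_{j-1}`,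
`η_{j+1} = ‖r‖` and `v_{j+1} = r / ‖r‖`.
If a residual vanishes then all later vectors are `0`; see `lastStep` for termination. -/
def state {n : ℕ} (A : Matrix (Fin n) (Fin n) ℝ) (v : Fin n → ℝ) :
    ℕ → (Fin n → ℝ) × (Fin n → ℝ) × ℝ
  | 0 => (0, (norm2 v)⁻¹ • v, 0)
  | j + 1 =>
    let u := (state A v j).1
    let w := (state A v j).2.1
    let η := (state A v j).2.2
    let r := A *ᵥ w - (w ⬝ᵥ A *ᵥ w) • w - η • u
    (w, (norm2 r)⁻¹ • r, norm2 r)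

/-- The Lanczos vector `v_j`. -/
def vec {n : ℕ} (A : Matrix (Fin n) (Fin n) ℝ) (v : Fin n → ℝ) (j : ℕ) : Fin n → ℝ :=
  (state A v j).2.1

/-- The diagonal coefficient `α_j = v_jᵀ A v_j`. -/
def alpha {n : ℕ} (A : Matrix (Fin n) (Fin n) ℝ) (v : Fin n → ℝ) (j : ℕ) : ℝ :=
  vec A v j ⬝ᵥ A *ᵥ vec A v j

/-- The off-diagonal coefficient `η_j`, coupling `v_{j-1}` and `v_j`. -/
def eta {n : ℕ} (A : Matrix (Fin n) (Fin n) ℝ) (v : Fin n → ℝ) (j : ℕ) : ℝ :=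
  (state A v j).2.2

/-- The `s × s` Jacobi matrix produced by `s` steps of the Lanczos algorithm. -/
def jacobi {n : ℕ} (A : Matrix (Fin n) (Fin n) ℝ) (v : Fin n → ℝ) (s : ℕ) :
    Matrix (Fin s) (Fin s) ℝ :=
  Matrix.of fun i j =>
    if i = j then alpha A v i
    else if (i : ℕ) + 1 = j then eta A v j
    else if (j : ℕ) + 1 = i then eta A v i
    else 0

theorem jacobi_isHermitian {n : ℕ} (A : Matrix (Fin n) (Fin n) ℝ) (v : Fin n → ℝ) (s : ℕ) :
    (jacobi A v s).IsHermitian := by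
  ext i j
  simp only [jacobi, conjTranspose_apply, of_apply, star_trivial]
  by_cases h : i = j
  · subst h; simp
  · have h2 : j ≠ i := fun e => h e.symm
    simp only [h, h2, if_false]
    split_ifs <;> first | rfl | omega

open Classical in
/-- The index of the last Lanczos vector computed when `m + 1` steps are requested.
It is `m`, unless a residual vanishes earlier, in which case the algorithm stops there. -/
def lastStep {n : ℕ} (A : Matrix (Fin n) (Fin n) ℝ) (v : Fin n → ℝ) (m : ℕ) : ℕ :=
  Nat.findGreatest (fun j => ∀ i ≤ j, vec A v i ≠ 0) m

/-- The `(m + 1)`-step Lanczos quadrature `∑ₗ τₗ f(θₗ)` for the quadratic form `vᵀ f(A) v`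
(for a unit vector `v`): the nodes `θₗ` are the eigenvalues of the Jacobi matrix `T`, and
`τₗ = (e₁ᵀ yₗ)²` for an orthonormal basis `yₗ` of eigenvectors of `T`. -/
def quadrature {n : ℕ} (f : ℝ → ℝ) (A : Matrix (Fin n) (Fin n) ℝ) (v : Fin n → ℝ) (m : ℕ) : ℝ :=
  let hT := jacobi_isHermitian A v (lastStep A v m + 1)
  ∑ l, (hT.eigenvectorBasis l 0) ^ 2 * f (hT.eigenvalues l)

/-- The `(m + 1)`-step Lanczos quadrature approximation of `tr (Qᵀ f(A) Q)`: the sum of the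
Lanczos quadratures over the `k` columns of `Q`. -/
def traceQuadrature {n k : ℕ} (f : ℝ → ℝ) (A : Matrix (Fin n) (Fin n) ℝ)
    (Q : Matrix (Fin n) (Fin k) ℝ) (m : ℕ) : ℝ :=
  ∑ i, quadrature f A (fun a => Q a i) m

end LanczosQuadrature

end

/-! Lanczos quadrature is `e₁ᵀ f(T) e₁` with `T = Vᵀ A V`, where the columns of `V` are the Lanczos
vectors. It is a Gauss rule: exact for degree `≤ 2 m + 1`, with nodes in `[lmin, lmax]`. For a unit
vector its error is therefore at most twice the uniform error of any such polynomial on that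
interval (`abs_dotProduct_cfc_sub_quadrature_le`).

For `log` the polynomial is explicit: after an affine change of variable, `log` becomes a constant
plus `2 Re log (1 + r e^{iθ})`, whose Taylor polynomial is a Chebyshev sum in `cos θ`
(`exists_polynomial_abs_log_sub_le`). Its rate `r` is at most `1 / ρ`, and its constant at most that
given by `M`, since `M ≥ 1`. Summing over the `k` orthonormal columns and using `C ≤ tr (log A)`
turns this into the relative bound. -/

namespace LanczosQuadrature

/-! ### Spectral sums, Rayleigh quotients and compressions. -/

section Spectral

variable {n : ℕ} {H : Matrix (Fin n) (Fin n) ℝ}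

/-- Integration against the spectral measure of `v`. It serves both for `A` with `v` and for the
Jacobi matrix with `e₁`, where the sum is the quadrature itself. -/
theorem dotProduct_cfc_mulVec (hH : H.IsHermitian) (f : ℝ → ℝ) (v : Fin n → ℝ) :
    v ⬝ᵥ cfc f H *ᵥ v =
      ∑ l, (⇑(hH.eigenvectorBasis l) ⬝ᵥ v) ^ 2 * f (hH.eigenvalues l) := by
  have hU : ∀ l, (star (hH.eigenvectorUnitary : Matrix (Fin n) (Fin n) ℝ) *ᵥ v) l =
      ⇑(hH.eigenvectorBasis l) ⬝ᵥ v := by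
    intro l
    simp [mulVec, dotProduct, star_apply, Matrix.IsHermitian.eigenvectorUnitary_apply]
  have hU' : v ᵥ* (hH.eigenvectorUnitary : Matrix (Fin n) (Fin n) ℝ) =
      star (hH.eigenvectorUnitary : Matrix (Fin n) (Fin n) ℝ) *ᵥ v := by
    rw [star_eq_conjTranspose, conjTranspose_eq_transpose_of_trivial, mulVec_transpose]
  rw [hH.cfc_eq, Matrix.IsHermitian.cfc, Unitary.conjStarAlgAut_apply, ← mulVec_mulVec,
    ← mulVec_mulVec, dotProduct_mulVec, hU']
  simp only [dotProduct, mulVec_diagonal, hU, Function.comp_apply, RCLike.ofReal_real_eq_id, id]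
  refine Finset.sum_congr rfl fun l _ => ?_
  rw [← dotProduct]
  ring

theorem sum_sq_eigenvectorBasis_dotProduct (hH : H.IsHermitian) (v : Fin n → ℝ) :
    ∑ l, (⇑(hH.eigenvectorBasis l) ⬝ᵥ v) ^ 2 = v ⬝ᵥ v := by
  have h := dotProduct_cfc_mulVec hH (fun _ => 1) v
  rw [cfc_const_one ℝ H hH.isSelfAdjoint] at h
  simpa using h.symm

theorem abs_dotProduct_cfc_sub_aeval_le (hH : H.IsHermitian) {f : ℝ → ℝ}
    {p : Polynomial ℝ} {δ : ℝ} {v : Fin n → ℝ} (hv : v ⬝ᵥ v = 1)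
    (hp : ∀ l, |f (hH.eigenvalues l) - p.eval (hH.eigenvalues l)| ≤ δ) :
    |v ⬝ᵥ cfc f H *ᵥ v - v ⬝ᵥ Polynomial.aeval H p *ᵥ v| ≤ δ := by
  rw [← cfc_polynomial p H hH.isSelfAdjoint, dotProduct_cfc_mulVec hH, dotProduct_cfc_mulVec hH,
    ← Finset.sum_sub_distrib]
  calc |∑ l, ((⇑(hH.eigenvectorBasis l) ⬝ᵥ v) ^ 2 * f (hH.eigenvalues l) -
          (⇑(hH.eigenvectorBasis l) ⬝ᵥ v) ^ 2 * p.eval (hH.eigenvalues l))|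
      ≤ ∑ l, (⇑(hH.eigenvectorBasis l) ⬝ᵥ v) ^ 2 * δ := by
        refine (Finset.abs_sum_le_sum_abs _ _).trans (Finset.sum_le_sum fun l _ => ?_)
        rw [← mul_sub, abs_mul, abs_of_nonneg (sq_nonneg _)]
        exact mul_le_mul_of_nonneg_left (hp l) (sq_nonneg _)
    _ = δ := by rw [← Finset.sum_mul, sum_sq_eigenvectorBasis_dotProduct, hv, one_mul]

/-- A Rayleigh quotient lies between any bounds on the eigenvalues. -/
theorem dotProduct_mulVec_mem_Icc (hH : H.IsHermitian) {a b : ℝ}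
    (hab : ∀ l, hH.eigenvalues l ∈ Set.Icc a b) {v : Fin n → ℝ} (hv : v ⬝ᵥ v = 1) :
    v ⬝ᵥ H *ᵥ v ∈ Set.Icc a b := by
  have h := dotProduct_cfc_mulVec hH (fun x => x) v
  rw [cfc_id' ℝ H hH.isSelfAdjoint] at h
  have hs := (sum_sq_eigenvectorBasis_dotProduct hH v).trans hv
  rw [h]
  constructor
  · calc a = ∑ l, (⇑(hH.eigenvectorBasis l) ⬝ᵥ v) ^ 2 * a := by
          rw [← Finset.sum_mul, hs, one_mul]
      _ ≤ _ := Finset.sum_le_sum fun l _ => mul_le_mul_of_nonneg_left (hab l).1 (sq_nonneg _)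
  · calc _ ≤ ∑ l, (⇑(hH.eigenvectorBasis l) ⬝ᵥ v) ^ 2 * b :=
          Finset.sum_le_sum fun l _ => mul_le_mul_of_nonneg_left (hab l).2 (sq_nonneg _)
      _ = b := by rw [← Finset.sum_mul, hs, one_mul]

theorem eigenvectorBasis_dotProduct_self (hH : H.IsHermitian) (l : Fin n) :
    ⇑(hH.eigenvectorBasis l) ⬝ᵥ ⇑(hH.eigenvectorBasis l) = 1 := by
  have h := hH.eigenvectorBasis.orthonormal.1 l
  have h2 := real_inner_self_eq_norm_sq (hH.eigenvectorBasis l)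
  rw [h, EuclideanSpace.inner_eq_star_dotProduct] at h2
  simpa using h2

/-- The eigenvalues of a compression `Vᵀ A V` lie between any bounds on those of `A`. -/
theorem eigenvalues_mem_Icc_of_compression {s : ℕ} (hH : H.IsHermitian) {a b : ℝ}
    (hab : ∀ l, hH.eigenvalues l ∈ Set.Icc a b) {V : Matrix (Fin n) (Fin s) ℝ}
    (hV : Vᵀ * V = 1) {T : Matrix (Fin s) (Fin s) ℝ} (hT : T.IsHermitian)
    (hVT : Vᵀ * H * V = T) (l : Fin s) : hT.eigenvalues l ∈ Set.Icc a b := by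
  have hy := eigenvectorBasis_dotProduct_self hT l
  set y : Fin s → ℝ := ⇑(hT.eigenvectorBasis l) with hyd
  -- With `B = 1` this makes `V y` a unit vector; with `B = H` its Rayleigh quotient is the
  -- eigenvalue of `T` at `y`.
  have hq : ∀ B : Matrix (Fin n) (Fin n) ℝ,
      (V *ᵥ y) ⬝ᵥ B *ᵥ (V *ᵥ y) = y ⬝ᵥ (Vᵀ * B * V) *ᵥ y := by
    intro B
    rw [← mulVec_mulVec, ← mulVec_mulVec, dotProduct_mulVec y, vecMul_transpose]
  have h1 : (V *ᵥ y) ⬝ᵥ (V *ᵥ y) = 1 := by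
    have := hq 1
    rwa [one_mulVec, Matrix.mul_one, hV, one_mulVec, hy] at this
  have h2 := dotProduct_mulVec_mem_Icc hH hab h1
  have h3 : T *ᵥ y = hT.eigenvalues l • y := hT.mulVec_eigenvectorBasis l
  rwa [hq, hVT, h3, dotProduct_smul, hy, smul_eq_mul, mul_one] at h2

theorem trace_cfc (hH : H.IsHermitian) (f : ℝ → ℝ) :
    (cfc f H).trace = ∑ l, f (hH.eigenvalues l) := by
  rw [hH.cfc_eq, Matrix.IsHermitian.cfc, Unitary.conjStarAlgAut_apply, trace_mul_comm,
    ← mul_assoc]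
  simp [trace_diagonal]

end Spectral

end LanczosQuadrature

namespace LanczosQuadrature

/-! ### Three-term recurrence, orthonormality, and `T = Vᵀ A V`. -/

section Recurrence

variable {n : ℕ} (A : Matrix (Fin n) (Fin n) ℝ) (v : Fin n → ℝ)

theorem norm2_eq_zero {x : Fin n → ℝ} : norm2 x = 0 ↔ x = 0 := by
  have h : 0 ≤ x ⬝ᵥ x := Finset.sum_nonneg fun i _ => mul_self_nonneg (x i)
  rw [norm2, Real.sqrt_eq_zero h, dotProduct_self_eq_zero]

theorem norm2_mul_self (x : Fin n → ℝ) : norm2 x * norm2 x = x ⬝ᵥ x :=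
  Real.mul_self_sqrt (Finset.sum_nonneg fun i _ => mul_self_nonneg (x i))

theorem norm2_smul_inv_smul (x : Fin n → ℝ) : norm2 x • (norm2 x)⁻¹ • x = x := by
  by_cases h : norm2 x = 0
  · rw [norm2_eq_zero.1 h]; simp
  · rw [smul_smul, mul_inv_cancel₀ h, one_smul]

theorem normalize_dotProduct_self {x : Fin n → ℝ} (h : (norm2 x)⁻¹ • x ≠ 0) :
    ((norm2 x)⁻¹ • x) ⬝ᵥ ((norm2 x)⁻¹ • x) = 1 := by
  have hx : norm2 x ≠ 0 := by
    intro h0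
    simp [h0] at h
  rw [smul_dotProduct, dotProduct_smul, ← norm2_mul_self, smul_eq_mul, smul_eq_mul]
  field_simp

/-- The Lanczos vector `v_{j-1}`, with `v_{-1} = 0`. -/
noncomputable def prevVec (j : ℕ) : Fin n → ℝ := (state A v j).1

/-- The residual at index `j`. -/
noncomputable def residual (j : ℕ) : Fin n → ℝ :=
  A *ᵥ vec A v j - alpha A v j • vec A v j - eta A v j • prevVec A v j

theorem prevVec_zero : prevVec A v 0 = 0 := rfl

theorem prevVec_succ (j : ℕ) : prevVec A v (j + 1) = vec A v j := rfl

theorem vec_zero : vec A v 0 = (norm2 v)⁻¹ • v := rfl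

theorem vec_succ (j : ℕ) :
    vec A v (j + 1) = (norm2 (residual A v j))⁻¹ • residual A v j := rfl

theorem eta_succ (j : ℕ) : eta A v (j + 1) = norm2 (residual A v j) := rfl

theorem eta_succ_smul_vec_succ (j : ℕ) :
    eta A v (j + 1) • vec A v (j + 1) = residual A v j := by
  rw [eta_succ, vec_succ, norm2_smul_inv_smul]

/-- The three-term recurrence. -/
theorem mulVec_vec (j : ℕ) : A *ᵥ vec A v j =
    eta A v (j + 1) • vec A v (j + 1) + alpha A v j • vec A v j + eta A v j • prevVec A v j := by
  rw [eta_succ_smul_vec_succ, residual]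
  abel

theorem vec_dotProduct_self {j : ℕ} (h : vec A v j ≠ 0) : vec A v j ⬝ᵥ vec A v j = 1 := by
  cases j with
  | zero => exact normalize_dotProduct_self h
  | succ j => exact normalize_dotProduct_self h

theorem residual_eq_zero_of_vec_succ {j : ℕ} (h : vec A v (j + 1) = 0) :
    residual A v j = 0 := by
  rw [← eta_succ_smul_vec_succ, h, smul_zero]

theorem eta_eq_zero_of_vec_succ {j : ℕ} (h : vec A v (j + 1) = 0) : eta A v (j + 1) = 0 := by
  rw [eta_succ, norm2_eq_zero]
  exact residual_eq_zero_of_vec_succ A v h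

theorem vec_eq_zero_of_le {j : ℕ} (h : vec A v (j + 1) = 0) {i : ℕ} (hi : j + 1 ≤ i) :
    vec A v i = 0 := by
  induction i, hi using Nat.le_induction with
  | base => exact h
  | succ i hi ih =>
    obtain ⟨i, rfl⟩ : ∃ i', i = i' + 1 := ⟨i - 1, by omega⟩
    rw [vec_succ, residual, ih, eta_eq_zero_of_vec_succ A v ih]
    simp

variable {A}

theorem dotProduct_mulVec_comm (hA : A.IsHermitian) (x y : Fin n → ℝ) :
    x ⬝ᵥ A *ᵥ y = (A *ᵥ x) ⬝ᵥ y := by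
  rw [dotProduct_mulVec, ← mulVec_transpose, ← conjTranspose_eq_transpose_of_trivial, hA.eq]

/-- Symmetry moves `A` onto the earlier vector, and the recurrence expands it into neighbours; only
the last two indices give nonzero terms, which cancel by the choice of coefficients. The vector at
`j` itself may vanish. -/
theorem vec_dotProduct_vec_of_lt (hA : A.IsHermitian) :
    ∀ j, (∀ i < j, vec A v i ≠ 0) → ∀ i < j, vec A v i ⬝ᵥ vec A v j = 0 := by
  intro j
  induction j using Nat.strong_induction_on with
  | _ j ih =>
  intro hne i hij
  obtain ⟨j, rfl⟩ : ∃ j', j = j' + 1 := ⟨j - 1, by omega⟩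
  have horth : ∀ a ≤ j, ∀ b ≤ j, a ≠ b → vec A v a ⬝ᵥ vec A v b = 0 := by
    intro a ha b hb hab
    rcases lt_or_gt_of_ne hab with h | h
    · exact ih b (by omega) (fun i hi => hne i (by omega)) a h
    · rw [dotProduct_comm]
      exact ih a (by omega) (fun i hi => hne i (by omega)) b h
  have hone : ∀ a ≤ j, vec A v a ⬝ᵥ vec A v a = 1 := fun a ha =>
    vec_dotProduct_self A v (hne a (by omega))
  rw [vec_succ, dotProduct_smul]
  suffices h : vec A v i ⬝ᵥ residual A v j = 0 by rw [h, smul_zero]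
  rw [residual, dotProduct_sub, dotProduct_sub, dotProduct_smul, dotProduct_smul]
  rcases Nat.lt_succ_iff_lt_or_eq.1 hij with hi | rfl
  · have hi0 : prevVec A v i ⬝ᵥ vec A v j = 0 := by
      cases i with
      | zero => rw [prevVec_zero, zero_dotProduct]
      | succ i => exact horth _ (by omega) _ le_rfl (by omega)
    rw [dotProduct_mulVec_comm hA, mulVec_vec, add_dotProduct, add_dotProduct, smul_dotProduct,
      smul_dotProduct, smul_dotProduct, hi0, horth i (by omega) j le_rfl (by omega)]
    obtain ⟨j, rfl⟩ : ∃ j', j = j' + 1 := ⟨j - 1, by omega⟩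
    rw [prevVec_succ]
    -- For adjacent indices `⟨A v_j, v_{j+1}⟩ = η_{j+1}` cancels the `prevVec` term.
    by_cases hij' : i = j
    · subst hij'
      rw [hone _ le_rfl, hone _ (by omega)]
      simp
    · rw [horth (i + 1) (by omega) (j + 1) le_rfl (by omega),
        horth i (by omega) j (by omega) hij']
      simp
  · have hi0 : vec A v i ⬝ᵥ prevVec A v i = 0 := by
      cases i with
      | zero => rw [prevVec_zero, dotProduct_zero]
      | succ i => exact horth _ le_rfl _ (by omega) (by omega)
    rw [hi0, hone _ le_rfl, alpha]
    simp

variable {v}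

/-- The range `j ≤ s + 1` includes the possibly zero vector just after the computed ones, which
enters the last column of the compression. -/
theorem vec_dotProduct_vec (hA : A.IsHermitian) {s : ℕ} (hs : ∀ i ≤ s, vec A v i ≠ 0)
    {i j : ℕ} (hi : i ≤ s) (hj : j ≤ s + 1) (hij : i ≠ j) : vec A v i ⬝ᵥ vec A v j = 0 := by
  rcases lt_or_gt_of_ne hij with h | h
  · exact vec_dotProduct_vec_of_lt v hA j (fun i hi => hs i (by omega)) i h
  · rw [dotProduct_comm]
    exact vec_dotProduct_vec_of_lt v hA i (fun i hi => hs i (by omega)) j h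

variable (A v)

/-- The matrix whose columns are the first `s` Lanczos vectors. -/
noncomputable def lanczosMatrix (s : ℕ) : Matrix (Fin n) (Fin s) ℝ := of fun a i => vec A v i a

variable {A v}

theorem lanczosMatrix_transpose_mul_self (hA : A.IsHermitian) {s : ℕ}
    (hs : ∀ i ≤ s, vec A v i ≠ 0) :
    (lanczosMatrix A v (s + 1))ᵀ * lanczosMatrix A v (s + 1) = 1 := by
  ext i j
  change vec A v i ⬝ᵥ vec A v j = _
  by_cases h : i = j
  · subst h
    rw [one_apply_eq, vec_dotProduct_self A v (hs i (by omega))]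
  · rw [one_apply_ne h, vec_dotProduct_vec hA hs (by omega) (by omega) (fun e => h (Fin.ext e))]

theorem lanczosMatrix_compression (hA : A.IsHermitian) {s : ℕ}
    (hs : ∀ i ≤ s, vec A v i ≠ 0) :
    (lanczosMatrix A v (s + 1))ᵀ * A * lanczosMatrix A v (s + 1) = jacobi A v (s + 1) := by
  ext i j
  have h1 : ((lanczosMatrix A v (s + 1))ᵀ * A * lanczosMatrix A v (s + 1)) i j =
      vec A v i ⬝ᵥ A *ᵥ vec A v j := by
    rw [Matrix.mul_assoc]
    rfl
  have hi : (i : ℕ) ≤ s := by omega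
  have hone := vec_dotProduct_self A v (hs i hi)
  have horth : ∀ b ≤ s + 1, (i : ℕ) ≠ b → vec A v i ⬝ᵥ vec A v b = 0 :=
    fun b hb h => vec_dotProduct_vec hA hs hi hb h
  rw [h1, jacobi, of_apply]
  by_cases h : i = j
  · subst h
    rw [if_pos rfl, alpha]
  have h' : (i : ℕ) ≠ j := fun e => h (Fin.ext e)
  rw [if_neg h, mulVec_vec, dotProduct_add, dotProduct_add, dotProduct_smul, dotProduct_smul,
    dotProduct_smul, horth j (by omega) h']
  have hprev : vec A v i ⬝ᵥ prevVec A v j = if (i : ℕ) + 1 = j then 1 else 0 := by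
    rcases hj : (j : ℕ) with _ | b
    · simp [prevVec_zero]
    · rw [prevVec_succ]
      by_cases hib : (i : ℕ) = b
      · rw [if_pos (by omega), ← hib, hone]
      · rw [if_neg (by omega), horth b (by omega) hib]
  rw [hprev]
  by_cases h2 : (i : ℕ) + 1 = j
  · rw [if_pos h2, if_pos h2, horth _ (by omega) (by omega)]
    simp
  · rw [if_neg h2, if_neg h2]
    by_cases h3 : (j : ℕ) + 1 = i
    · rw [if_pos h3, h3, hone]
      simp
    · rw [if_neg h3, horth _ (by omega) (by omega)]
      simp

end Recurrence

/-! ### Krylov spaces and exactness of the quadrature. -/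

section Exactness

variable {n : ℕ} {A : Matrix (Fin n) (Fin n) ℝ} {v : Fin n → ℝ}

theorem vec_zero_of_unit (hv : v ⬝ᵥ v = 1) : vec A v 0 = v := by
  rw [vec_zero, norm2, hv]
  simp

theorem vec_ne_zero_of_le_lastStep (hv : v ⬝ᵥ v = 1) (m : ℕ) :
    ∀ i ≤ lastStep A v m, vec A v i ≠ 0 := by
  classical
  have h0 : ∀ i ≤ 0, vec A v i ≠ 0 := by
    intro i hi h
    obtain rfl : i = 0 := by omega
    rw [vec_zero_of_unit hv] at h
    simp [h] at hv
  unfold lastStep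
  exact Nat.findGreatest_spec (P := fun j => ∀ i ≤ j, vec A v i ≠ 0) (Nat.zero_le m) h0

theorem vec_lastStep_succ (hv : v ⬝ᵥ v = 1) {m : ℕ} (h : lastStep A v m < m) :
    vec A v (lastStep A v m + 1) = 0 := by
  classical
  by_contra hne
  have hall : ∀ i ≤ lastStep A v m + 1, vec A v i ≠ 0 := by
    intro i hi
    rcases Nat.le_succ_iff.1 hi with h' | rfl
    · exact vec_ne_zero_of_le_lastStep hv m i h'
    · exact hne
  have := Nat.le_findGreatest (P := fun j => ∀ i ≤ j, vec A v i ≠ 0)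
    (show lastStep A v m + 1 ≤ m from h) hall
  exact absurd this (by unfold lastStep; omega)

theorem mulVec_mem_span_vec {j : ℕ} {x : Fin n → ℝ}
    (hx : x ∈ Submodule.span ℝ (vec A v '' Set.Iic j)) :
    A *ᵥ x ∈ Submodule.span ℝ (vec A v '' Set.Iic (j + 1)) := by
  have hmem : ∀ i ≤ j + 1, vec A v i ∈ Submodule.span ℝ (vec A v '' Set.Iic (j + 1)) :=
    fun i hi => Submodule.subset_span ⟨i, hi, rfl⟩
  induction hx using Submodule.span_induction with
  | mem x hx =>
    obtain ⟨i, hi, rfl⟩ := hx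
    have hi' : i ≤ j := hi
    rw [mulVec_vec]
    refine add_mem (add_mem ?_ ?_) ?_ <;> refine Submodule.smul_mem _ _ ?_
    · exact hmem _ (by omega)
    · exact hmem _ (by omega)
    · cases i with
      | zero => exact zero_mem _
      | succ i => exact hmem i (by omega)
  | zero => rw [mulVec_zero]; exact zero_mem _
  | add x y _ _ hx hy => rw [mulVec_add]; exact add_mem hx hy
  | smul c x _ hx => rw [mulVec_smul]; exact Submodule.smul_mem _ _ hx

theorem pow_mulVec_mem_span_vec (hv : v ⬝ᵥ v = 1) (j : ℕ) :
    A ^ j *ᵥ v ∈ Submodule.span ℝ (vec A v '' Set.Iic j) := by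
  induction j with
  | zero =>
    rw [pow_zero, one_mulVec]
    exact Submodule.subset_span ⟨0, Set.mem_Iic.2 le_rfl, vec_zero_of_unit hv⟩
  | succ j ih =>
    rw [pow_succ', ← mulVec_mulVec]
    exact mulVec_mem_span_vec ih

/-- After an early stop all later Lanczos vectors are zero, so the computed ones still span the
Krylov space. -/
theorem pow_mulVec_mem_span_lastStep (hv : v ⬝ᵥ v = 1) {m j : ℕ} (hj : j ≤ m) :
    A ^ j *ᵥ v ∈ Submodule.span ℝ (vec A v '' Set.Iic (lastStep A v m)) := by
  refine Submodule.span_le.2 ?_ (pow_mulVec_mem_span_vec hv j)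
  rintro _ ⟨i, hi, rfl⟩
  have hi' : i ≤ j := hi
  by_cases h : i ≤ lastStep A v m
  · exact Submodule.subset_span ⟨i, h, rfl⟩
  · rw [vec_eq_zero_of_le A v (vec_lastStep_succ hv (m := m) (by omega)) (by omega)]
    exact zero_mem _

/-- The orthogonal projection `V Vᵀ` fixes the span of the Lanczos vectors. -/
theorem lanczosMatrix_proj (hA : A.IsHermitian) {s : ℕ} (hs : ∀ i ≤ s, vec A v i ≠ 0)
    {x : Fin n → ℝ} (hx : x ∈ Submodule.span ℝ (vec A v '' Set.Iic s)) :
    lanczosMatrix A v (s + 1) *ᵥ ((lanczosMatrix A v (s + 1))ᵀ *ᵥ x) = x := by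
  induction hx using Submodule.span_induction with
  | mem x hx =>
    obtain ⟨i, hi, rfl⟩ := hx
    have hi' : i ≤ s := hi
    have hcol : vec A v i = lanczosMatrix A v (s + 1) *ᵥ Pi.single ⟨i, by omega⟩ 1 := by
      ext a
      simp [lanczosMatrix]
    rw [hcol, mulVec_mulVec _ (lanczosMatrix A v (s + 1))ᵀ,
      lanczosMatrix_transpose_mul_self hA hs, one_mulVec]
  | zero => simp
  | add x y _ _ hx hy => rw [mulVec_add, mulVec_add, hx, hy]
  | smul c x _ hx => rw [mulVec_smul, mulVec_smul, hx]

/-- The exponent may reach `m + 1`, beyond the span fixed by `V Vᵀ`: the projection is inserted only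
before the last factor `A`. -/
theorem lanczosMatrix_transpose_mulVec_pow (hA : A.IsHermitian) (hv : v ⬝ᵥ v = 1) {m j : ℕ}
    (hj : j ≤ m + 1) :
    (lanczosMatrix A v (lastStep A v m + 1))ᵀ *ᵥ (A ^ j *ᵥ v) =
      jacobi A v (lastStep A v m + 1) ^ j *ᵥ Pi.single 0 1 := by
  have hs := vec_ne_zero_of_le_lastStep (A := A) hv m
  induction j with
  | zero =>
    have hcol : v = lanczosMatrix A v (lastStep A v m + 1) *ᵥ Pi.single 0 1 := by
      ext a
      simp [lanczosMatrix, vec_zero_of_unit hv]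
    rw [pow_zero, pow_zero, one_mulVec, one_mulVec]
    refine (congrArg _ hcol).trans ?_
    rw [mulVec_mulVec, lanczosMatrix_transpose_mul_self hA hs, one_mulVec]
  | succ j ih =>
    rw [pow_succ' (jacobi _ _ _), ← mulVec_mulVec, ← ih (by omega), pow_succ', ← mulVec_mulVec,
      ← lanczosMatrix_compression hA hs, ← mulVec_mulVec, ← mulVec_mulVec,
      lanczosMatrix_proj hA hs (pow_mulVec_mem_span_lastStep hv (by omega))]

theorem dotProduct_pow_mulVec_eq_jacobi (hA : A.IsHermitian) (hv : v ⬝ᵥ v = 1) {m d : ℕ}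
    (hd : d ≤ 2 * m + 1) :
    v ⬝ᵥ A ^ d *ᵥ v = Pi.single 0 1 ⬝ᵥ
      jacobi A v (lastStep A v m + 1) ^ d *ᵥ (Pi.single 0 1 : Fin _ → ℝ) := by
  have hs := vec_ne_zero_of_le_lastStep (A := A) hv m
  -- Only `A ^ i v` has to be fixed by `V Vᵀ`, so the other exponent may be `m + 1`; hence the total
  -- degree `2 m + 1`.
  obtain ⟨i, j, hi, hj, rfl⟩ : ∃ i j, i ≤ m ∧ j ≤ m + 1 ∧ d = i + j :=
    ⟨min d m, d - min d m, by omega, by omega, by omega⟩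
  have hsplit : ∀ {r : ℕ} {B : Matrix (Fin r) (Fin r) ℝ} (_ : B.IsHermitian) (x : Fin r → ℝ),
      x ⬝ᵥ B ^ (i + j) *ᵥ x = (B ^ i *ᵥ x) ⬝ᵥ (B ^ j *ᵥ x) := by
    intro r B hB x
    rw [pow_add, ← mulVec_mulVec, dotProduct_mulVec_comm (hB.pow i)]
  rw [hsplit hA, hsplit (jacobi_isHermitian _ _ _),
    ← lanczosMatrix_transpose_mulVec_pow hA hv (by omega : i ≤ m + 1),
    ← lanczosMatrix_transpose_mulVec_pow hA hv hj, dotProduct_mulVec _ _ᵀ, vecMul_transpose,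
    lanczosMatrix_proj hA hs (pow_mulVec_mem_span_lastStep hv hi)]

/-- Lanczos quadrature with `m + 1` steps is exact for polynomials of degree `≤ 2 m + 1`. -/
theorem dotProduct_aeval_mulVec_eq_jacobi (hA : A.IsHermitian) (hv : v ⬝ᵥ v = 1) {m : ℕ}
    {p : Polynomial ℝ} (hp : p.natDegree ≤ 2 * m + 1) :
    v ⬝ᵥ Polynomial.aeval A p *ᵥ v = Pi.single 0 1 ⬝ᵥ
      Polynomial.aeval (jacobi A v (lastStep A v m + 1)) p *ᵥ
        (Pi.single 0 1 : Fin _ → ℝ) := by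
  have hp' : p.natDegree < 2 * m + 2 := by omega
  rw [Polynomial.aeval_eq_sum_range' hp', Polynomial.aeval_eq_sum_range' hp',
    sum_mulVec, sum_mulVec, dotProduct_sum, dotProduct_sum]
  refine Finset.sum_congr rfl fun d hd => ?_
  rw [smul_mulVec, smul_mulVec, dotProduct_smul, dotProduct_smul,
    dotProduct_pow_mulVec_eq_jacobi hA hv (m := m) (by have := Finset.mem_range.1 hd; omega)]

/-- The error of Lanczos quadrature is at most twice the error of uniform approximation by
polynomials of degree `≤ 2 m + 1`. -/
theorem abs_dotProduct_cfc_sub_quadrature_le (hA : A.IsHermitian) (hv : v ⬝ᵥ v = 1) {m : ℕ}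
    {f : ℝ → ℝ} {p : Polynomial ℝ} (hp : p.natDegree ≤ 2 * m + 1) {a b δ : ℝ}
    (hab : ∀ l, hA.eigenvalues l ∈ Set.Icc a b)
    (hδ : ∀ x ∈ Set.Icc a b, |f x - p.eval x| ≤ δ) :
    |v ⬝ᵥ cfc f A *ᵥ v - quadrature f A v m| ≤ 2 * δ := by
  have hs := vec_ne_zero_of_le_lastStep (A := A) hv m
  have hT := jacobi_isHermitian A v (lastStep A v m + 1)
  have hq : quadrature f A v m = Pi.single 0 1 ⬝ᵥ
      cfc f (jacobi A v (lastStep A v m + 1)) *ᵥ (Pi.single 0 1 : Fin _ → ℝ) := by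
    rw [dotProduct_cfc_mulVec hT]
    simp [quadrature]
  have h1 := abs_dotProduct_cfc_sub_aeval_le hA hv fun l => hδ _ (hab l)
  have h2 := abs_dotProduct_cfc_sub_aeval_le hT (v := Pi.single 0 1) (by simp) fun l =>
    hδ _ (eigenvalues_mem_Icc_of_compression hA hab (lanczosMatrix_transpose_mul_self hA hs) hT
      (lanczosMatrix_compression hA hs) l)
  rw [dotProduct_aeval_mulVec_eq_jacobi hA hv hp] at h1
  rw [hq]
  rw [abs_le] at h1 h2 ⊢
  constructor <;> linarith [h1.1, h1.2, h2.1, h2.2]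

end Exactness

end LanczosQuadrature

namespace LanczosQuadrature

/-! ### Chebyshev approximation of the logarithm. -/

section LogApproximation

/-- The Chebyshev partial sum of `t ↦ log (1 + r² + 2 r t)`. -/
noncomputable def logChebyshev (r : ℝ) (N : ℕ) : Polynomial ℝ :=
  ∑ j ∈ Finset.range (N + 1),
    -- The term `j = 0` is zero, because division by zero gives `0`.
    Polynomial.C (2 * ((-1) ^ (j + 1) * r ^ j / j)) * Polynomial.Chebyshev.T ℝ j

theorem natDegree_logChebyshev_le (r : ℝ) (N : ℕ) : (logChebyshev r N).natDegree ≤ N := by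
  refine Polynomial.natDegree_sum_le_of_forall_le _ _ fun j hj => ?_
  refine (Polynomial.natDegree_C_mul_le _ _).trans ?_
  rw [Polynomial.Chebyshev.natDegree_T]
  simpa using Nat.lt_succ_iff.1 (Finset.mem_range.1 hj)

/-- With `t = cos θ` and `z = r e^{iθ}`, the argument of `log` is `|1 + z|²`, and `T_j (cos θ) = cos
(j θ)` makes the sum `2 Re` of the Taylor polynomial of `log (1 + z)`. -/
theorem abs_log_sub_logChebyshev_le {r : ℝ} (hr0 : 0 ≤ r) (hr1 : r < 1) (N : ℕ) {t : ℝ}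
    (ht : t ∈ Set.Icc (-1 : ℝ) 1) :
    |Real.log (1 + r ^ 2 + 2 * r * t) - (logChebyshev r N).eval t| ≤
      2 * (r ^ (N + 1) / (1 - r)) := by
  obtain ⟨θ, rfl⟩ : ∃ θ, t = Real.cos θ := ⟨Real.arccos t, (Real.cos_arccos ht.1 ht.2).symm⟩
  set z : ℂ := r * Complex.exp (θ * Complex.I) with hz
  have hzn : ‖z‖ = r := by
    rw [hz, norm_mul, Complex.norm_exp_ofReal_mul_I, mul_one, Complex.norm_real,
      Real.norm_of_nonneg hr0]
  have hpow : ∀ j : ℕ, z ^ j = ((r ^ j : ℝ) : ℂ) * Complex.exp (((j * θ : ℝ) : ℂ) * Complex.I) := by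
    intro j
    rw [hz, mul_pow, ← Complex.exp_nat_mul]
    push_cast
    ring_nf
  have hnorm : ‖1 + z‖ ^ 2 = 1 + r ^ 2 + 2 * r * Real.cos θ := by
    rw [← Complex.normSq_eq_norm_sq, Complex.normSq_apply]
    simp only [hz, Complex.add_re, Complex.one_re, Complex.add_im, Complex.one_im,
      Complex.re_ofReal_mul, Complex.im_ofReal_mul, Complex.exp_ofReal_mul_I_re,
      Complex.exp_ofReal_mul_I_im]
    nlinarith [Real.sin_sq_add_cos_sq θ]
  have hlog : Real.log (1 + r ^ 2 + 2 * r * Real.cos θ) = 2 * (Complex.log (1 + z)).re := by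
    rw [Complex.log_re, ← hnorm, Real.log_pow]
    push_cast
    rfl
  have hpoly : (logChebyshev r N).eval (Real.cos θ) = 2 * (Complex.logTaylor (N + 1) z).re := by
    rw [logChebyshev, Polynomial.eval_finsetSum, Complex.logTaylor, Complex.re_sum,
      Finset.mul_sum]
    refine Finset.sum_congr rfl fun j _ => ?_
    have hT : (Polynomial.Chebyshev.T ℝ (j : ℤ)).eval (Real.cos θ) = Real.cos (j * θ) := by
      simp
    have hc : (-1 : ℂ) ^ (j + 1) * z ^ j / j = (((-1) ^ (j + 1) * r ^ j / j : ℝ) : ℂ) *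
        Complex.exp (((j * θ : ℝ) : ℂ) * Complex.I) := by
      rw [hpow]
      push_cast
      ring
    rw [Polynomial.eval_C_mul, hT, hc, Complex.re_ofReal_mul, Complex.exp_ofReal_mul_I_re]
    ring
  have hmain := Complex.norm_log_sub_logTaylor_le N (z := z) (by rw [hzn]; exact hr1)
  rw [hzn] at hmain
  have h1r : 0 < 1 - r := by linarith
  have hle : r ^ (N + 1) * (1 - r)⁻¹ / (N + 1) ≤ r ^ (N + 1) / (1 - r) := by
    rw [← div_eq_mul_inv]
    exact div_le_self (by positivity) (by linarith [N.cast_nonneg (α := ℝ)])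
  rw [hlog, hpoly, ← mul_sub, ← Complex.sub_re, abs_mul, abs_two]
  have := (Complex.abs_re_le_norm _).trans (hmain.trans hle)
  linarith

/-- Polynomial approximation of `log` on `[a, b]`, at the rate of the Bernstein ellipse through
the origin. -/
theorem exists_polynomial_abs_log_sub_le {a b : ℝ} (ha : 0 < a) (hab : a < b) (N : ℕ) :
    ∃ p : Polynomial ℝ, p.natDegree ≤ N ∧ ∀ x ∈ Set.Icc a b, |Real.log x - p.eval x| ≤
      2 * (((√b - √a) / (√b + √a)) ^ (N + 1) / (1 - (√b - √a) / (√b + √a))) := by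
  have hsa : 0 < √a := Real.sqrt_pos.2 ha
  have hsab : √a < √b := Real.sqrt_lt_sqrt ha.le hab
  have ha2 : √a ^ 2 = a := Real.sq_sqrt ha.le
  have hb2 : √b ^ 2 = b := Real.sq_sqrt (ha.trans hab).le
  set u := √a
  set w := √b
  set r := (w - u) / (w + u) with hr
  have hr0 : 0 < r := div_pos (by linarith) (by linarith)
  have hr1 : r < 1 := by rw [hr, div_lt_one (by linarith)]; linarith
  -- `r` and `β` solve `β (1 - r)² = a` and `β (1 + r)² = b`, so `x = β (1 + r² + 2 r t)` maps `[-1,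
  -- 1]` onto `[a, b]`.
  set β := (w + u) ^ 2 / 4 with hβ
  have hβ0 : 0 < β := by positivity
  have hwu : w + u ≠ 0 := by positivity
  have h1 : β * (1 - r) ^ 2 = a := by
    rw [hβ, hr, ← ha2]; field_simp; ring
  have h2 : β * (1 + r) ^ 2 = b := by
    rw [hβ, hr, ← hb2]; field_simp; ring
  refine ⟨Polynomial.C (Real.log β) + (logChebyshev r N).comp
    (Polynomial.C (1 / (2 * r * β)) * Polynomial.X + Polynomial.C (-(1 + r ^ 2) / (2 * r))),
    ?_, ?_⟩
  · refine Polynomial.natDegree_add_le_of_degree_le (by simp) ?_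
    refine Polynomial.natDegree_comp_le.trans ?_
    calc _ ≤ N * 1 := Nat.mul_le_mul (natDegree_logChebyshev_le r N)
            Polynomial.natDegree_linear_le
      _ = N := mul_one N
  · intro x hx
    set t := 1 / (2 * r * β) * x + -(1 + r ^ 2) / (2 * r) with ht
    have hxt : x = β * (1 + r ^ 2 + 2 * r * t) := by
      rw [ht]; field_simp; ring
    have hrβ : 0 < r * β := mul_pos hr0 hβ0
    have htm : t ∈ Set.Icc (-1 : ℝ) 1 := by
      constructor
      · by_contra hlt
        push Not at hlt
        nlinarith [hx.1, mul_lt_mul_of_pos_left hlt hrβ]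
      · by_contra hlt
        push Not at hlt
        nlinarith [hx.2, mul_lt_mul_of_pos_left hlt hrβ]
    have hpos : 1 + r ^ 2 + 2 * r * t ≠ 0 := by
      intro h0
      rw [h0, mul_zero] at hxt
      linarith [hx.1]
    have hlog : Real.log x = Real.log β + Real.log (1 + r ^ 2 + 2 * r * t) := by
      rw [← Real.log_mul hβ0.ne' hpos, ← hxt]
    rw [hlog]
    simp only [Polynomial.eval_add, Polynomial.eval_C, Polynomial.eval_comp, Polynomial.eval_mul,
      Polynomial.eval_X]
    rw [← ht, add_sub_add_left_eq_sub]
    exact abs_log_sub_logChebyshev_le hr0.le hr1 N htm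

end LogApproximation

/-! ### Comparison of the rate `r` with `1 / ρ`. -/

section Rate

variable {a b : ℝ}

theorem one_lt_bernstein_radius (ha : 0 < a) (hab : a < b) :
    1 < (b + √(2 * b * a - a ^ 2)) / (b - a) := by
  rw [one_lt_div (by linarith)]
  linarith [Real.sqrt_nonneg (2 * b * a - a ^ 2)]

/-- The Bernstein ellipse with foci `a`, `b` and parameter `ρ` passes through `a / 2`, inside the
one through `0`, whose parameter is `1 / r`. -/
theorem chebyshev_rate_le_inv (ha : 0 < a) (hab : a < b) :
    (√b - √a) / (√b + √a) ≤ ((b + √(2 * b * a - a ^ 2)) / (b - a))⁻¹ := by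
  have hsa : 0 < √a := Real.sqrt_pos.2 ha
  have hsab : √a < √b := Real.sqrt_lt_sqrt ha.le hab
  have ha2 : √a ^ 2 = a := Real.sq_sqrt ha.le
  have hb2 : √b ^ 2 = b := Real.sq_sqrt (ha.trans hab).le
  have hsq : √(2 * b * a - a ^ 2) ≤ a + 2 * √b * √a := by
    rw [Real.sqrt_le_left (by positivity)]
    have h : (√b * √a) ^ 2 = b * a := by rw [mul_pow, ha2, hb2]
    nlinarith [mul_pos (hsa.trans hsab) hsa, mul_pos ha (ha.trans hab)]
  have h0 := Real.sqrt_nonneg (2 * b * a - a ^ 2)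
  rw [inv_div, div_le_div_iff₀ (by linarith) (by linarith)]
  calc (√b - √a) * (b + √(2 * b * a - a ^ 2))
      ≤ (√b - √a) * (√b + √a) ^ 2 := by
        refine mul_le_mul_of_nonneg_left ?_ (by linarith)
        nlinarith
    _ = (b - a) * (√b + √a) := by
        have : b - a = √b ^ 2 - √a ^ 2 := by rw [ha2, hb2]
        rw [this]; ring

/-- The truncation error in terms of the larger rate `1 / ρ`. -/
theorem geom_tail_le {r ρ : ℝ} (hr0 : 0 ≤ r) (hρ : 1 < ρ) (hr : r ≤ ρ⁻¹) (m : ℕ) :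
    r ^ (2 * m + 1 + 1) / (1 - r) ≤ 1 / (ρ ^ (2 * m) * (ρ ^ 2 - ρ)) := by
  have hρ0 : 0 < ρ := by linarith
  have hi : ρ⁻¹ < 1 := inv_lt_one_of_one_lt₀ hρ
  have h1 : ρ - 1 ≠ 0 := by linarith
  calc r ^ (2 * m + 1 + 1) / (1 - r) ≤ ρ⁻¹ ^ (2 * m + 1 + 1) / (1 - ρ⁻¹) :=
        div_le_div₀ (by positivity) (pow_le_pow_left₀ hr0 hr _) (by linarith) (by linarith)
    _ = 1 / (ρ ^ (2 * m) * (ρ ^ 2 - ρ)) := by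
        have h2 : ρ ^ 2 - ρ = ρ * (ρ - 1) := by ring
        have h3 : 1 - ρ⁻¹ = (ρ - 1) / ρ := by field_simp
        rw [h2, h3, inv_pow, pow_succ, pow_succ]
        field_simp

end Rate

end LanczosQuadrature

/-! ### Assembly of the trace bound. -/

theorem mainTheorem4 {n q k : ℕ} {Ω : Type*} [MeasurableSpace Ω]
    (P : MeasureTheory.Measure Ω) [MeasureTheory.IsProbabilityMeasure P]
    (ε : ℝ) (hε : ε ∈ Set.Ioo (0 : ℝ) 1)
    (A : Matrix (Fin n) (Fin n) ℝ) (hA : A.PosDef)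
    (lmin lmax M ρ C Cρ : ℝ)
    (hlmin : lmin = sInf (spectrum ℝ A)) (hlmax : lmax = sSup (spectrum ℝ A))
    (hone : 1 ≤ lmin)
    (hM : M = |Real.log (lmin / 2)| + Real.pi)
    (hρ : ρ = (lmax + √(2 * lmax * lmin - lmin ^ 2)) / (lmax - lmin))
    (hC : C = ((n : ℝ) - 1) * Real.log lmin + Real.log lmax)
    (hCρ : Cρ = 4 * M / (C * (ρ ^ 2 - ρ)))
    (S : Ω → Matrix (Fin n) (Fin q) ℝ)
    (hSlaw : ∀ i j, ProbabilityTheory.HasLaw (fun ω => S ω i j)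
      (ProbabilityTheory.gaussianReal 0 (1 / (q : NNReal))) P)
    (hSindep : ProbabilityTheory.iIndepFun (fun (p : Fin n × Fin q) ω => S ω p.1 p.2) P)
    (m' : ℕ)
    (hm : lmin < lmax → 1 / 2 * Real.log (2 * k * Cρ / ε) / Real.log ρ ≤ m') :
    ∀ ω : Ω, ∀ Q : Matrix (Fin n) (Fin k) ℝ,
      LanczosQuadrature.IsPrincipalBasis (cfc Real.log A * S ω) Q →
      |(Qᵀ * cfc Real.log A * Q).trace
          - LanczosQuadrature.traceQuadrature Real.log A Q m'|
        ≤ ε / 2 * (cfc Real.log A).trace := by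
  intro ω Q hQ
  have hH : A.IsHermitian := hA.1
  have hspec := hH.spectrum_real_eq_range_eigenvalues
  have hfin : (spectrum ℝ A).Finite := hspec ▸ Set.finite_range _
  -- An empty spectrum would give `sInf ∅ = 0`, against `1 ≤ lmin`; this excludes `n = 0`.
  have hne : (spectrum ℝ A).Nonempty := by
    by_contra h
    rw [Set.not_nonempty_iff_eq_empty.1 h, Real.sInf_empty] at hlmin
    linarith
  have hmem : ∀ l, hH.eigenvalues l ∈ Set.Icc lmin lmax := fun l => by
    have h := hH.eigenvalues_mem_spectrum_real l
    exact ⟨hlmin ▸ csInf_le hfin.bddBelow h, hlmax ▸ le_csSup hfin.bddAbove h⟩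
  obtain ⟨l₀, hl₀⟩ : ∃ l, hH.eigenvalues l = lmax := by
    have := hne.csSup_mem hfin
    rwa [← hlmax, hspec] at this
  have hle : lmin ≤ lmax := (hmem l₀).1.trans (hmem l₀).2
  have hlogmin : 0 ≤ Real.log lmin := Real.log_nonneg hone
  -- One eigenvalue equals `lmax`; the other `n - 1` are at least `lmin`.
  have htrace : C ≤ (cfc Real.log A).trace := by
    rw [LanczosQuadrature.trace_cfc hH, ← Finset.add_sum_erase _ _ (Finset.mem_univ l₀), hl₀, hC,
      add_comm]
    gcongr
    have hcard : (((Finset.univ.erase l₀).card : ℕ) : ℝ) = (n : ℝ) - 1 := by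
      have : 0 < n := l₀.pos
      rw [Finset.card_erase_of_mem (Finset.mem_univ _), Finset.card_univ, Fintype.card_fin,
        Nat.cast_sub this, Nat.cast_one]
    rw [← hcard, ← nsmul_eq_mul]
    exact Finset.card_nsmul_le_sum _ _ _ fun l _ =>
      Real.log_le_log (by linarith) (hmem l).1
  have hn : (1 : ℝ) ≤ n := by exact_mod_cast l₀.pos
  have hsum : ∀ {δ : ℝ} {p : Polynomial ℝ}, p.natDegree ≤ 2 * m' + 1 →
      (∀ x ∈ Set.Icc lmin lmax, |Real.log x - p.eval x| ≤ δ) →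
      |(Qᵀ * cfc Real.log A * Q).trace - LanczosQuadrature.traceQuadrature Real.log A Q m'| ≤
        k * (2 * δ) := by
    intro δ p hp hδ
    have htr : (Qᵀ * cfc Real.log A * Q).trace =
        ∑ i, (fun a => Q a i) ⬝ᵥ cfc Real.log A *ᵥ fun a => Q a i := by
      rw [Matrix.mul_assoc]
      rfl
    rw [htr, LanczosQuadrature.traceQuadrature, ← Finset.sum_sub_distrib]
    refine (Finset.abs_sum_le_sum_abs _ _).trans ?_
    refine (Finset.sum_le_card_nsmul _ _ (2 * δ) fun i _ => ?_).trans (by simp)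
    refine LanczosQuadrature.abs_dotProduct_cfc_sub_quadrature_le hH ?_ hp hmem hδ
    have := congrFun (congrFun hQ.1 i) i
    rwa [one_apply_eq] at this
  have hC0 : 0 ≤ C := by
    rw [hC]
    exact add_nonneg (mul_nonneg (by linarith) hlogmin) (Real.log_nonneg (hone.trans hle))
  have hgoal : ε / 2 * C ≤ ε / 2 * (cfc Real.log A).trace :=
    mul_le_mul_of_nonneg_left htrace (by linarith [hε.1])
  refine le_trans ?_ hgoal
  have hrhs : 0 ≤ ε / 2 * C := mul_nonneg (by linarith [hε.1]) hC0
  -- If `lmin = lmax`, a constant polynomial is exact on the interval, for every `m'`.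
  rcases hle.eq_or_lt with heq | hlt
  · have h := hsum (δ := 0) (p := Polynomial.C (Real.log lmin)) (by simp) fun x hx => by
      have : x = lmin := le_antisymm (heq ▸ hx.2) hx.1
      simp [this]
    linarith
  obtain ⟨p, hp, hδ⟩ := LanczosQuadrature.exists_polynomial_abs_log_sub_le
    (by linarith : 0 < lmin) hlt (2 * m' + 1)
  refine (hsum hp hδ).trans ?_
  have hpos : 0 < lmin := by linarith
  have hρ1 : 1 < ρ := hρ ▸ LanczosQuadrature.one_lt_bernstein_radius hpos hlt
  have hsab : √lmin < √lmax := Real.sqrt_lt_sqrt hpos.le hlt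
  have htail := LanczosQuadrature.geom_tail_le
    (div_nonneg (by linarith) (by positivity) : 0 ≤ (√lmax - √lmin) / (√lmax + √lmin))
    hρ1 (hρ ▸ LanczosQuadrature.chebyshev_rate_le_inv hpos hlt) m'
  set δ := ((√lmax - √lmin) / (√lmax + √lmin)) ^ (2 * m' + 1 + 1) /
    (1 - (√lmax - √lmin) / (√lmax + √lmin))
  have hM1 : 1 ≤ M := by
    rw [hM]
    linarith [abs_nonneg (Real.log (lmin / 2)), Real.pi_gt_three]
  have hCpos : 0 < C := by
    rw [hC]
    exact add_pos_of_nonneg_of_pos (mul_nonneg (by linarith) hlogmin)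
      (Real.log_pos (hone.trans_lt hlt))
  have hρρ : 0 < ρ ^ 2 - ρ := by nlinarith
  have hCρ0 : 0 < Cρ := by rw [hCρ]; positivity
  -- For `k = 0` the argument of the logarithm in `hm` is `0`, so `hm` cannot be exponentiated; both
  -- traces are then empty sums.
  rcases Nat.eq_zero_or_pos k with rfl | hk
  · simpa using hrhs
  have hk' : (0 : ℝ) < k := by exact_mod_cast hk
  have hε0 := hε.1
  have hpow : 2 * k * Cρ / ε ≤ ρ ^ (2 * m') := by
    have h := hm hlt
    rw [div_le_iff₀ (Real.log_pos hρ1)] at h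
    rw [← Real.log_le_log_iff (by positivity) (by positivity), Real.log_pow]
    push_cast
    linarith
  have hρm : 0 < ρ ^ (2 * m') := by positivity
  rw [div_le_iff₀ hε0, hCρ] at hpow
  calc (k : ℝ) * (2 * (2 * δ)) = 4 * k * δ := by ring
    _ ≤ 4 * k * (M * (1 / (ρ ^ (2 * m') * (ρ ^ 2 - ρ)))) := by
        refine mul_le_mul_of_nonneg_left (htail.trans ?_) (by positivity)
        exact le_mul_of_one_le_left (by positivity) hM1
    _ = 2 * k * (4 * M / (C * (ρ ^ 2 - ρ))) * (C / (2 * ρ ^ (2 * m'))) := by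
        field_simp
    _ ≤ ρ ^ (2 * m') * ε * (C / (2 * ρ ^ (2 * m'))) :=
        mul_le_mul_of_nonneg_right hpow (by positivity)
    _ = ε / 2 * C := by
        field_simp
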